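/- **Setting.** Let $(\Gamma,+,0,\le)$ be a totally ordered abelian group. The tropical semifield $\mathbb{T}_{\max}(\Gamma)$ is $\Gamma\cup\{\bot\}$ with addition $\oplus=\max$ and multiplication $\odot=+$, where $\bot$ is the bottom element, is absorbing for $\odot$ and is the zero element. Equip $\mathbb{T}_{\max}(\Gamma)^2$ with the componentwise addition, the multiplication $$(a_1,a_2)\odot(b_1,b_2)=(a_1\odot b_1\oplus a_2\odot b_2,\;a_1\odot b_2\oplus a_2\odot b_1)$$ and the negation $\ominus(a_1,a_2)=(a_2,a_1)$. The symmetrized tropical semiring $\mathbb{S}_{\max}=\mathbb{S}_{\max}(\Gamma)$ is the quotient of $\mathbb{T}_{\max}(\Gamma)^2$ by the congruence $\mathcal R$ for which $(a_1,a_2)\,\mathcal R\,(b_1,b_2)$ means $a_1\oplus b_2=a_2\oplus b_1$ if $a_1\ne a_2$ and $b_1\ne b_2$, and $(a_1,a_2)=(b_1,b_2)$ otherwise. Write $\mathbb{0}$ for its zero element, $\mathbb{S}_{\max}^\vee$ for the set of signed elements, i.e. the classes of $(c,\bot)$ and $(\bot,c)$ with $c\in\Gamma\cup\{\bot\}$,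 and $a\preceq^\circ b$ if $b=a\oplus e$ with $e$ the class of some $(c,c)$, $c\in\Gamma\cup\{\bot\}$. A map $\mathrm{sv}$ from a field $R$ to $\mathbb{S}_{\max}$ is a morphism of semiring systems (from $R$, with tangible elements $R\setminus\{0\}$, the usual negation and equality as surpassing relation, to $\mathbb{S}_{\max}$, with tangible elements $\mathbb{S}_{\max}^\vee\setminus\{\mathbb{0}\}$, negation $\ominus$ and surpassing relation $\preceq^\circ$) if, for all $a,a'\in R$ and $b\in R\setminus\{0\}$, $$\mathrm{sv}(0)=\mathbb{0},\quad \mathrm{sv}(b)\in\mathbb{S}_{\max}^\vee\setminus\{\mathbb{0}\},\quad \mathrm{sv}(-a)=\ominus\,\mathrm{sv}(a),\quad \mathrm{sv}(a+a')\preceq^\circ\mathrm{sv}(a)\oplus\mathrm{sv}(a'),\quad \mathrm{sv}(ba)=\mathrm{sv}(b)\odot\mathrm{sv}(a).$$ Such a map takes its values in $\mathbb{S}_{\max}^\vee$. **Statement.** Assume that $\Gamma$ is divisible, let $R$ be an ordered field and let $\mathrm{sv}:R\to\mathbb{S}_{\max}^\vee(\Gamma)$ be a morphism of semiring systems. Let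 $x_1,\dots,x_n\in R$ and let $$\mathbf{P}=\sum_{k=0}^n\mathbf{P}_k\mathsf{Y}^k=(\mathsf{Y}-x_1)\cdots(\mathsf{Y}-x_n)\in R[\mathsf{Y}].$$ Let $P=\mathrm{sv}(\mathbf{P}):=\bigoplus_{k=0}^n\mathrm{sv}(\mathbf{P}_k)\,\mathsf{Y}^k$ and let $\widehat P:\mathbb{S}_{\max}\to\mathbb{S}_{\max}$, $y\mapsto\bigoplus_{k=0}^n\mathrm{sv}(\mathbf{P}_k)\odot y^{\odot k}$, be the associated polynomial function. Then $$\widehat P(y)=(y\ominus\mathrm{sv}(x_1))\odot\cdots\odot(y\ominus\mathrm{sv}(x_n))\qquad\text{for all }y\in\mathbb{S}_{\max}(\Gamma).$$ -/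

import Mathlib

open Polynomial

/-- The tropical semifield `T_max(Γ) = (Γ ∪ {⊥}, max, +)` over an ordered abelian group `Γ`. -/
def TMax (Γ : Type*) : Type _ := WithBot Γ

namespace TMax

variable {Γ : Type*} [AddCommGroup Γ] [LinearOrder Γ]

instance : LinearOrder (TMax Γ) := inferInstanceAs (LinearOrder (WithBot Γ))

/-- The zero element is the bottom element `⊥`. -/
instance : Zero (TMax Γ) := ⟨(⊥ : WithBot Γ)⟩

/-- The unit element is the neutral element of `Γ`. -/
instance : One (TMax Γ) := ⟨((0 : Γ) : WithBot Γ)⟩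

/-- Tropical addition is the maximum. -/
instance : Add (TMax Γ) := ⟨fun a b => max a b⟩

/-- Tropical multiplication is the addition of `Γ`, with `⊥` absorbing. -/
instance : Mul (TMax Γ) :=
  ⟨fun a b => (show WithBot Γ from ((show WithBot Γ from a) + (show WithBot Γ from b)))⟩

theorem add_eq_max (a b : TMax Γ) : a + b = max a b := rfl

theorem zero_le' (a : TMax Γ) : 0 ≤ a := (bot_le : (⊥ : WithBot Γ) ≤ a)

variable [IsOrderedAddMonoid Γ]

theorem mul_mono {a b : TMax Γ} (c : TMax Γ) (h : a ≤ b) : c * a ≤ c * b :=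
  add_le_add (α := WithBot Γ) le_rfl h

instance : CommSemiring (TMax Γ) where
  add_assoc a b c := max_assoc a b c
  zero_add a := max_eq_right (zero_le' a)
  add_zero a := max_eq_left (zero_le' a)
  add_comm a b := max_comm a b
  nsmul := nsmulRec
  mul_assoc a b c := add_assoc (G := WithBot Γ) a b c
  one_mul a := zero_add (M := WithBot Γ) a
  mul_one a := add_zero (M := WithBot Γ) a
  mul_comm a b := add_comm (G := WithBot Γ) a b
  zero_mul a := WithBot.bot_add (a : WithBot Γ)
  mul_zero a := WithBot.add_bot (a : WithBot Γ)
  left_distrib a b c := (show Monotone (fun x => a * x) from fun _ _ h => mul_mono a h).map_max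
  right_distrib a b c := (show Monotone (fun x => x * c) from fun x y h => by
    have := mul_mono c h
    rwa [show c * x = x * c from add_comm (G := WithBot Γ) c x,
      show c * y = y * c from add_comm (G := WithBot Γ) c y] at this).map_max

theorem mul_strictMono {a b c : TMax Γ} (hc : c ≠ 0) (h : a < b) : c * a < c * b :=
  WithBot.add_lt_add_left (α := Γ) hc h

theorem exists_inv {c : TMax Γ} (hc : c ≠ 0) : ∃ d : TMax Γ, d * c = 1 := by
  obtain ⟨g, rfl⟩ := WithBot.ne_bot_iff_exists.1 hc
  refine ⟨((-g : Γ) : WithBot Γ), ?_⟩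
  change ((-g : Γ) : WithBot Γ) + ((g : Γ) : WithBot Γ) = ((0 : Γ) : WithBot Γ)
  rw [← WithBot.coe_add, neg_add_cancel]

theorem zero_ne_one' : (0 : TMax Γ) ≠ 1 := WithBot.bot_ne_coe

end TMax

/-- Pairs `(a₁, a₂)` of elements of `T_max(Γ)`. -/
@[ext] structure TPair (Γ : Type*) where
  fst : TMax Γ
  snd : TMax Γ

namespace TPair

variable {Γ : Type*} [AddCommGroup Γ] [LinearOrder Γ] [IsOrderedAddMonoid Γ]

instance : Zero (TPair Γ) := ⟨⟨0, 0⟩⟩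
instance : One (TPair Γ) := ⟨⟨1, 0⟩⟩
instance : Add (TPair Γ) := ⟨fun a b => ⟨a.fst + b.fst, a.snd + b.snd⟩⟩
instance : Mul (TPair Γ) :=
  ⟨fun a b => ⟨a.fst * b.fst + a.snd * b.snd, a.fst * b.snd + a.snd * b.fst⟩⟩
instance : Neg (TPair Γ) := ⟨fun a => ⟨a.snd, a.fst⟩⟩

theorem add_def (a b : TPair Γ) : a + b = ⟨a.fst + b.fst, a.snd + b.snd⟩ := rfl
theorem mul_def (a b : TPair Γ) :
    a * b = ⟨a.fst * b.fst + a.snd * b.snd, a.fst * b.snd + a.snd * b.fst⟩ := rfl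
theorem zero_def : (0 : TPair Γ) = ⟨0, 0⟩ := rfl
theorem one_def : (1 : TPair Γ) = ⟨1, 0⟩ := rfl
theorem neg_def (a : TPair Γ) : -a = ⟨a.snd, a.fst⟩ := rfl

instance : CommSemiring (TPair Γ) where
  add_assoc a b c := by simp only [add_def, add_assoc]
  zero_add a := by simp only [add_def, zero_def, zero_add]
  add_zero a := by simp only [add_def, zero_def, add_zero]
  add_comm a b := by simp only [add_def, add_comm]
  nsmul := nsmulRec
  mul_assoc a b c := by
    simp only [mul_def]
    ext <;> dsimp only <;> ring
  one_mul a := by simp [mul_def, one_def]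
  mul_one a := by simp [mul_def, one_def]
  mul_comm a b := by
    simp only [mul_def]
    ext <;> dsimp only <;> ring
  zero_mul a := by simp [mul_def, zero_def]
  mul_zero a := by simp [mul_def, zero_def]
  left_distrib a b c := by
    simp only [mul_def, add_def]
    ext <;> dsimp only <;> ring
  right_distrib a b c := by
    simp only [mul_def, add_def]
    ext <;> dsimp only <;> ring

/-- The equivalence relation on pairs refining the balance relation
`a₁ ⊕ b₂ = a₂ ⊕ b₁`. -/
def Rel (a b : TPair Γ) : Prop :=
  (a.fst ≠ a.snd ∧ b.fst ≠ b.snd ∧ a.fst + b.snd = a.snd + b.fst) ∨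
    (¬ (a.fst ≠ a.snd ∧ b.fst ≠ b.snd) ∧ a = b)

theorem rel_iff (a b : TPair Γ) : Rel a b ↔
    a = b ∨ (a.snd < a.fst ∧ b.snd < b.fst ∧ a.fst = b.fst) ∨
      (a.fst < a.snd ∧ b.fst < b.snd ∧ a.snd = b.snd) := by
  obtain ⟨a₁, a₂⟩ := a
  obtain ⟨b₁, b₂⟩ := b
  simp only [Rel, TMax.add_eq_max, TPair.mk.injEq]
  grind

theorem rel_refl (a : TPair Γ) : Rel a a := (rel_iff _ _).2 (Or.inl rfl)

theorem rel_symm {a b : TPair Γ} (h : Rel a b) : Rel b a := by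
  rw [rel_iff] at h ⊢
  grind

theorem rel_trans {a b c : TPair Γ} (h : Rel a b) (h' : Rel b c) : Rel a c := by
  rw [rel_iff] at h h' ⊢
  grind

theorem rel_add_right {a b : TPair Γ} (h : Rel a b) (c : TPair Γ) : Rel (a + c) (b + c) := by
  rw [rel_iff] at h ⊢
  obtain ⟨a₁, a₂⟩ := a
  obtain ⟨b₁, b₂⟩ := b
  obtain ⟨c₁, c₂⟩ := c
  simp only [add_def, TMax.add_eq_max, TPair.mk.injEq] at h ⊢
  grind

theorem rel_neg {a b : TPair Γ} (h : Rel a b) : Rel (-a) (-b) := by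
  rw [rel_iff] at h ⊢
  obtain ⟨a₁, a₂⟩ := a
  obtain ⟨b₁, b₂⟩ := b
  simp only [neg_def, TPair.mk.injEq] at h ⊢
  grind

theorem neg_mul' (a b : TPair Γ) : -(a * b) = -a * b := by
  simp only [neg_def, mul_def]
  ext <;> dsimp only <;> ring

theorem neg_neg' (a : TPair Γ) : - -a = a := rfl

theorem mul_of_lt {a₁ a₂ b₁ b₂ : TMax Γ} (ha : a₂ < a₁) (hb : b₂ < b₁) :
    a₁ * b₂ + a₂ * b₁ < a₁ * b₁ + a₂ * b₂ ∧ a₁ * b₁ + a₂ * b₂ = a₁ * b₁ := by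
  have ha0 : a₁ ≠ 0 := (lt_of_le_of_lt (TMax.zero_le' _) ha).ne'
  have hb0 : b₁ ≠ 0 := (lt_of_le_of_lt (TMax.zero_le' _) hb).ne'
  have h1 : a₁ * b₂ < a₁ * b₁ := TMax.mul_strictMono ha0 hb
  have h2 : b₁ * a₂ < b₁ * a₁ := TMax.mul_strictMono hb0 ha
  have h3 : a₂ * b₂ ≤ a₂ * b₁ := TMax.mul_mono _ hb.le
  rw [mul_comm b₁, mul_comm b₁] at h2
  simp only [TMax.add_eq_max]
  grind

theorem rel_mul_right {a b : TPair Γ} (h : Rel a b) (c : TPair Γ) : Rel (a * c) (b * c) := by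
  have pos : ∀ {x y z : TPair Γ}, x.snd < x.fst → y.snd < y.fst → x.fst = y.fst →
      z.snd ≤ z.fst → Rel (x * z) (y * z) := by
    rintro ⟨x₁, x₂⟩ ⟨y₁, y₂⟩ ⟨z₁, z₂⟩ hx hy hxy hz
    simp only at hx hy hxy hz
    subst hxy
    rw [rel_iff]
    simp only [mul_def, TPair.mk.injEq]
    rcases hz.lt_or_eq with hz | rfl
    · obtain ⟨h1, h2⟩ := mul_of_lt hx hz
      obtain ⟨h3, h4⟩ := mul_of_lt hy hz
      exact Or.inr (Or.inl ⟨h1, h3, h2.trans h4.symm⟩)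
    · left
      have h1 : x₁ * z₂ + x₂ * z₂ = x₁ * z₂ := by
        rw [← add_mul, TMax.add_eq_max, max_eq_left hx.le]
      have h2 : x₁ * z₂ + y₂ * z₂ = x₁ * z₂ := by
        rw [← add_mul, TMax.add_eq_max, max_eq_left hy.le]
      exact ⟨h1.trans h2.symm, h1.trans h2.symm⟩
  have pos' : ∀ {x y z : TPair Γ}, x.snd < x.fst → y.snd < y.fst → x.fst = y.fst →
      Rel (x * z) (y * z) := by
    intro x y z hx hy hxy
    rcases le_total z.snd z.fst with hz | hz
    · exact pos hx hy hxy hz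
    · have h1 := rel_neg (pos (z := -z) hx hy hxy hz)
      rwa [mul_comm x, mul_comm y, neg_mul', neg_mul', neg_neg', mul_comm z, mul_comm z] at h1
  rcases (rel_iff a b).1 h with rfl | ⟨h1, h2, h3⟩ | ⟨h1, h2, h3⟩
  · exact rel_refl _
  · exact pos' h1 h2 h3
  · have h4 := rel_neg (pos' (x := -a) (y := -b) (z := c) h1 h2 h3)
    rwa [neg_mul', neg_mul', neg_neg', neg_neg'] at h4

/-- `Rel` is a congruence for both operations. -/
def con (Γ : Type*) [AddCommGroup Γ] [LinearOrder Γ] [IsOrderedAddMonoid Γ] :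
    RingCon (TPair Γ) where
  r := Rel
  iseqv := ⟨rel_refl, rel_symm, rel_trans⟩
  add' {a b c d} h h' := by
    refine rel_trans (rel_add_right h c) ?_
    rw [add_comm b c, add_comm b d]
    exact rel_add_right h' b
  mul' {a b c d} h h' := by
    refine rel_trans (rel_mul_right h c) ?_
    rw [mul_comm b c, mul_comm b d]
    exact rel_mul_right h' b

end TPair

/-- The symmetrized tropical semiring `S_max(Γ)`, the quotient of the semiring of pairs. -/
def SMax (Γ : Type*) [AddCommGroup Γ] [LinearOrder Γ] [IsOrderedAddMonoid Γ] : Type _ :=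
  (TPair.con Γ).Quotient

namespace SMax

variable {Γ : Type*} [AddCommGroup Γ] [LinearOrder Γ] [IsOrderedAddMonoid Γ]

instance : CommSemiring (SMax Γ) := inferInstanceAs (CommSemiring (TPair.con Γ).Quotient)

/-- The class of the pair `(a₁, a₂)`. -/
def mk (a₁ a₂ : TMax Γ) : SMax Γ := ((⟨a₁, a₂⟩ : TPair Γ) : (TPair.con Γ).Quotient)

/-- The minus operator `⊖`, induced by `(a₁, a₂) ↦ (a₂, a₁)`. -/
instance : Neg (SMax Γ) :=
  ⟨Quotient.map' (fun a : TPair Γ => -a) fun _ _ h => TPair.rel_neg h⟩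

theorem mk_eq_mk {a₁ a₂ b₁ b₂ : TMax Γ} :
    mk a₁ a₂ = mk b₁ b₂ ↔ TPair.Rel ⟨a₁, a₂⟩ ⟨b₁, b₂⟩ := (TPair.con Γ).eq

theorem zero_def : (0 : SMax Γ) = mk 0 0 := rfl
theorem one_def : (1 : SMax Γ) = mk 1 0 := rfl
theorem neg_mk (a₁ a₂ : TMax Γ) : -mk a₁ a₂ = mk a₂ a₁ := rfl
theorem mk_add_mk (a₁ a₂ b₁ b₂ : TMax Γ) : mk a₁ a₂ + mk b₁ b₂ = mk (a₁ + b₁) (a₂ + b₂) := rfl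
theorem mk_mul_mk (a₁ a₂ b₁ b₂ : TMax Γ) :
    mk a₁ a₂ * mk b₁ b₂ = mk (a₁ * b₁ + a₂ * b₂) (a₁ * b₂ + a₂ * b₁) := rfl

theorem exists_mk (a : SMax Γ) : ∃ a₁ a₂, a = mk a₁ a₂ := by
  obtain ⟨⟨a₁, a₂⟩, rfl⟩ := Quotient.exists_rep a
  exact ⟨a₁, a₂, rfl⟩

variable (Γ)

/-- Positive or zero elements. -/
def nonneg : Set (SMax Γ) := {a | ∃ c : TMax Γ, a = mk c 0}

/-- Negative or zero elements. -/
def nonpos : Set (SMax Γ) := {a | ∃ c : TMax Γ, a = mk 0 c}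

/-- Balance elements. -/
def balanced : Set (SMax Γ) := {a | ∃ c : TMax Γ, a = mk c c}

/-- Signed elements, `S_max^∨`. -/
def signed : Set (SMax Γ) := nonneg Γ ∪ nonpos Γ

variable {Γ}

/-- The relation `a ⪯° b`: `b = a ⊕ c` for some balance element `c`. -/
def Surpass (a b : SMax Γ) : Prop := ∃ c ∈ balanced Γ, b = a + c

theorem neg_neg' (a : SMax Γ) : - -a = a := by
  obtain ⟨a₁, a₂, rfl⟩ := exists_mk a
  rfl

theorem neg_add' (a b : SMax Γ) : -(a + b) = -a + -b := by
  obtain ⟨a₁, a₂, rfl⟩ := exists_mk a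
  obtain ⟨b₁, b₂, rfl⟩ := exists_mk b
  rfl

theorem neg_mul' (a b : SMax Γ) : -(a * b) = -a * b := by
  obtain ⟨a₁, a₂, rfl⟩ := exists_mk a
  obtain ⟨b₁, b₂, rfl⟩ := exists_mk b
  simp only [neg_mk, mk_mul_mk]
  congr 1 <;> ring

theorem mk_self_eq {a₁ a₂ c : TMax Γ} : mk a₁ a₂ = mk c c ↔ a₁ = c ∧ a₂ = c := by
  rw [mk_eq_mk, TPair.rel_iff]
  simp

theorem pos_ne_zero {c : TMax Γ} : mk c 0 ≠ 0 ↔ c ≠ 0 := by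
  rw [zero_def, Ne, mk_self_eq]
  simp

theorem neg_ne_zero' {a : SMax Γ} (h : a ≠ 0) : -a ≠ 0 := fun h' => h (by
  rw [← neg_neg' a, h']; rfl)

theorem signed_cases {a : SMax Γ} (h : a ∈ signed Γ) : ∃ c, a = mk c 0 ∨ a = -mk c 0 := by
  rcases h with ⟨c, rfl⟩ | ⟨c, rfl⟩
  · exact ⟨c, Or.inl rfl⟩
  · exact ⟨c, Or.inr rfl⟩

theorem neg_mem_signed {a : SMax Γ} (h : a ∈ signed Γ) : -a ∈ signed Γ := by
  rcases h with ⟨c, rfl⟩ | ⟨c, rfl⟩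
  · exact Or.inr ⟨c, rfl⟩
  · exact Or.inl ⟨c, rfl⟩

theorem exists_inv {a : SMax Γ} (h : a ∈ signed Γ) (h0 : a ≠ 0) : ∃ b : SMax Γ, b * a = 1 := by
  have key : ∀ c : TMax Γ, c ≠ 0 → ∃ d, mk d 0 * mk c 0 = (1 : SMax Γ) := by
    intro c hc
    obtain ⟨d, hd⟩ := TMax.exists_inv hc
    exact ⟨d, by simp [mk_mul_mk, hd, one_def]⟩
  obtain ⟨c, rfl | rfl⟩ := signed_cases h
  · obtain ⟨d, hd⟩ := key c (pos_ne_zero.1 h0)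
    exact ⟨_, hd⟩
  · have hc : c ≠ 0 := by
      rintro rfl
      exact h0 rfl
    obtain ⟨d, hd⟩ := key c hc
    refine ⟨-mk d 0, ?_⟩
    rw [← neg_mul', mul_comm, ← neg_mul', mul_comm, hd, neg_neg']

theorem zero_ne_one' : (1 : SMax Γ) ≠ 0 := by
  rw [one_def, pos_ne_zero]
  exact TMax.zero_ne_one'.symm

theorem mul_mem_signed {a b : SMax Γ} (ha : a ∈ signed Γ) (hb : b ∈ signed Γ) :
    a * b ∈ signed Γ := by
  have key : ∀ c d : TMax Γ, mk c 0 * mk d 0 ∈ signed Γ := fun c d =>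
    Or.inl ⟨c * d, by simp [mk_mul_mk]⟩
  obtain ⟨c, rfl | rfl⟩ := signed_cases ha <;> obtain ⟨d, rfl | rfl⟩ := signed_cases hb
  · exact key c d
  · rw [mul_comm, ← neg_mul']
    exact neg_mem_signed (key d c)
  · rw [← neg_mul']
    exact neg_mem_signed (key c d)
  · rw [← neg_mul', mul_comm, ← neg_mul', neg_neg']
    exact key d c

theorem balanced_add {a b : SMax Γ} (ha : a ∈ balanced Γ) (hb : b ∈ balanced Γ) :
    a + b ∈ balanced Γ := by
  obtain ⟨c, rfl⟩ := ha
  obtain ⟨d, rfl⟩ := hb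
  exact ⟨c + d, rfl⟩

theorem balanced_mul {a : SMax Γ} (b : SMax Γ) (ha : a ∈ balanced Γ) : b * a ∈ balanced Γ := by
  obtain ⟨c, rfl⟩ := ha
  obtain ⟨b₁, b₂, rfl⟩ := exists_mk b
  exact ⟨b₁ * c + b₂ * c, rfl⟩

theorem zero_mem_balanced : (0 : SMax Γ) ∈ balanced Γ := ⟨0, rfl⟩

theorem surpass_eq {b b' : SMax Γ} (hb : b ∈ signed Γ) (hb' : b' ∈ signed Γ)
    (h : Surpass b b') : b = b' := by
  have z := fun x : TMax Γ => TMax.zero_le' x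
  obtain ⟨_, ⟨e, rfl⟩, he⟩ := h
  rcases hb with ⟨c, rfl⟩ | ⟨c, rfl⟩ <;> rcases hb' with ⟨d, rfl⟩ | ⟨d, rfl⟩ <;>
  · rw [mk_add_mk, mk_eq_mk, TPair.rel_iff] at he
    rw [mk_eq_mk, TPair.rel_iff]
    have := z c
    have := z d
    have := z e
    simp only [TMax.add_eq_max, TPair.mk.injEq] at he ⊢
    grind

theorem unique_neg {b b' : SMax Γ} (hb : b ∈ signed Γ) (hb' : b' ∈ signed Γ)
    (h : Surpass 0 (b + -b')) : b = b' := by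
  have z := fun x : TMax Γ => TMax.zero_le' x
  obtain ⟨_, ⟨e, rfl⟩, he⟩ := h
  rw [zero_add] at he
  rcases hb with ⟨c, rfl⟩ | ⟨c, rfl⟩ <;> rcases hb' with ⟨d, rfl⟩ | ⟨d, rfl⟩ <;>
  · rw [neg_mk, mk_add_mk, mk_self_eq] at he
    rw [mk_eq_mk, TPair.rel_iff]
    have := z c
    have := z d
    simp only [TMax.add_eq_max, TPair.mk.injEq] at he ⊢
    grind

end SMax

/-- A commutative semiring system on a commutative semiring `A`. -/
structure SemiringSystem (A : Type*) [CommSemiring A] where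
  /-- The set of tangible elements. -/
  tangible : Submonoid A
  zero_notMem : (0 : A) ∉ tangible
  generates : AddSubmonoid.closure (tangible : Set A) = ⊤
  cancel : ∀ b ∈ tangible, ∀ a a' : A, b * a = b * a' → a = a'
  /-- The negation `⊖`. -/
  neg : A → A
  neg_neg : ∀ a, neg (neg a) = a
  neg_add : ∀ a b, neg (a + b) = neg a + neg b
  neg_mul : ∀ a b, neg (a * b) = neg a * b
  /-- The surpassing relation `⊴`. -/
  surpass : A → A → Prop
  refl : ∀ a, surpass a a
  trans : ∀ a b c, surpass a b → surpass b c → surpass a c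
  add_compat : ∀ a b c d, surpass a b → surpass c d → surpass (a + c) (b + d)
  mul_compat : ∀ a b c d, surpass a b → surpass c d → surpass (a * c) (b * d)
  surpass_zero : ∀ a, surpass 0 (a + neg a)
  eq_of_surpass : ∀ b b', (b ∈ tangible ∨ b = 0) → (b' ∈ tangible ∨ b' = 0) →
    surpass b b' → b = b'
  unique_neg : ∀ b b', (b ∈ tangible ∨ b = 0) → (b' ∈ tangible ∨ b' = 0) →
    surpass 0 (b + neg b') → b = b'

/-- Morphisms of semiring systems. -/
structure SemiringSystem.IsMorphism {A B : Type*} [CommSemiring A] [CommSemiring B]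
    (S : SemiringSystem A) (T : SemiringSystem B) (φ : A → B) : Prop where
  map_zero : φ 0 = 0
  map_tangible : ∀ a ∈ S.tangible, φ a ∈ T.tangible
  map_neg : ∀ a, φ (S.neg a) = T.neg (φ a)
  map_add : ∀ a a', T.surpass (φ (a + a')) (φ a + φ a')
  map_mul : ∀ b ∈ S.tangible, ∀ a, φ (b * a) = φ b * φ a
  map_surpass : ∀ a a', S.surpass a a' → T.surpass (φ a) (φ a')

/-- A field as a semiring system: tangible elements are the nonzero elements, the negation is
the usual one and the surpassing relation is equality. -/
def fieldSystem (K : Type*) [Field K] : SemiringSystem K where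
  tangible :=
    { carrier := {a | a ≠ 0}
      one_mem' := one_ne_zero
      mul_mem' := fun ha hb => mul_ne_zero ha hb }
  zero_notMem := fun h => h rfl
  generates := by
    rw [eq_top_iff]
    intro a _
    by_cases h : a = 0
    · rw [h]
      exact zero_mem _
    · exact AddSubmonoid.subset_closure h
  cancel b hb a a' h := mul_left_cancel₀ hb h
  neg a := -a
  neg_neg a := by ring
  neg_add a b := by ring
  neg_mul a b := by ring
  surpass a b := a = b
  refl _ := rfl
  trans _ _ _ h h' := h.trans h'
  add_compat _ _ _ _ h h' := by rw [h, h']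
  mul_compat _ _ _ _ h h' := by rw [h, h']
  surpass_zero a := by ring
  eq_of_surpass _ _ _ _ h := h
  unique_neg b b' _ _ h := by linear_combination -h

/-- The semiring system `S_max(Γ)`: tangible elements are the nonzero signed elements, the
negation is `⊖` and the surpassing relation is `⪯°`. -/
def SMax.system (Γ : Type*) [AddCommGroup Γ] [LinearOrder Γ] [IsOrderedAddMonoid Γ] :
    SemiringSystem (SMax Γ) where
  tangible :=
    { carrier := {a | a ∈ signed Γ ∧ a ≠ 0}
      one_mem' := ⟨Or.inl ⟨1, rfl⟩, zero_ne_one'⟩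
      mul_mem' := by
        rintro a b ⟨ha, ha0⟩ ⟨hb, hb0⟩
        refine ⟨mul_mem_signed ha hb, fun h => hb0 ?_⟩
        obtain ⟨c, hc⟩ := exists_inv ha ha0
        rw [← one_mul b, ← hc, mul_assoc, h, mul_zero] }
  zero_notMem := fun h => h.2 rfl
  generates := by
    rw [eq_top_iff]
    intro a _
    have key : ∀ x ∈ signed Γ,
        x ∈ AddSubmonoid.closure {a : SMax Γ | a ∈ signed Γ ∧ a ≠ 0} := by
      intro x hx
      by_cases h : x = 0
      · rw [h]
        exact zero_mem _
      · exact AddSubmonoid.subset_closure ⟨hx, h⟩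
    obtain ⟨a₁, a₂, rfl⟩ := exists_mk a
    have h : mk a₁ a₂ = mk a₁ 0 + mk 0 a₂ := by simp [mk_add_mk]
    rw [h]
    exact add_mem (key _ (Or.inl ⟨a₁, rfl⟩)) (key _ (Or.inr ⟨a₂, rfl⟩))
  cancel b hb a a' h := by
    obtain ⟨c, hc⟩ := exists_inv hb.1 hb.2
    rw [← one_mul a, ← one_mul a', ← hc, mul_assoc, mul_assoc, h]
  neg a := -a
  neg_neg := neg_neg'
  neg_add := neg_add'
  neg_mul := neg_mul'
  surpass := Surpass
  refl a := ⟨0, zero_mem_balanced, (add_zero a).symm⟩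
  trans := by
    rintro a _ _ ⟨c, hc, rfl⟩ ⟨d, hd, rfl⟩
    exact ⟨c + d, balanced_add hc hd, add_assoc _ _ _⟩
  add_compat := by
    rintro a _ c _ ⟨e, he, rfl⟩ ⟨f, hf, rfl⟩
    exact ⟨e + f, balanced_add he hf, by ring⟩
  mul_compat := by
    rintro a _ c _ ⟨e, he, rfl⟩ ⟨f, hf, rfl⟩
    exact ⟨a * f + c * e + e * f, balanced_add (balanced_add (balanced_mul a hf)
      (balanced_mul c he)) (balanced_mul e hf), by ring⟩
  surpass_zero a := by
    obtain ⟨a₁, a₂, rfl⟩ := exists_mk a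
    exact ⟨mk (a₁ + a₂) (a₁ + a₂), ⟨_, rfl⟩, by rw [neg_mk, mk_add_mk, zero_add, add_comm a₂]⟩
  eq_of_surpass b b' hb hb' h := by
    have h0 : (0 : SMax Γ) ∈ signed Γ := Or.inl ⟨0, rfl⟩
    exact surpass_eq (hb.elim (fun h => h.1) (fun h => h ▸ h0))
      (hb'.elim (fun h => h.1) (fun h => h ▸ h0)) h
  unique_neg b b' hb hb' h := by
    have h0 : (0 : SMax Γ) ∈ signed Γ := Or.inl ⟨0, rfl⟩
    exact SMax.unique_neg (hb.elim (fun h => h.1) (fun h => h ▸ h0))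
      (hb'.elim (fun h => h.1) (fun h => h ▸ h0)) h

/-- The formal polynomial `⨁_k φ(P_k) Y^k` obtained by applying `φ` to the coefficients. -/
noncomputable def mapCoeffs {A B : Type*} [CommSemiring A] [CommSemiring B] (φ : A → B)
    (P : A[X]) : B[X] :=
  ∑ k ∈ Finset.range (P.natDegree + 1), monomial k (φ (P.coeff k))


/-! The map `|sv|`, with `|(a₁, a₂)| = a₁ ⊕ a₂`, is a valuation on `R`, so Gauss's lemma makes the
two sides agree in modulus, while the axioms of a morphism give `P̂(y) ⪯° ∏ᵢ (y ⊖ sv(xᵢ))`. If the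
product is not balanced, `⪯°` below it is already equality. If it is balanced, then some factor
`y ⊖ sv(xᵢ)` is, which amounts to `sv(xᵢ) ⪯° y`; as polynomial functions are monotone for `⪯°`,
`𝟘 = sv(P(xᵢ)) ⪯° P̂(sv(xᵢ)) ⪯° P̂(y)`, so that `P̂(y)` is balanced too, and balanced elements are
determined by their modulus. -/

section MapCoeffs

variable {A B C : Type*} [CommSemiring A] [CommSemiring B] [CommSemiring C] {φ : A → B}

theorem eval_mapCoeffs (φ : A → B) (P : A[X]) (y : B) :
    (mapCoeffs φ P).eval y = ∑ k ∈ Finset.range (P.natDegree + 1), φ (P.coeff k) * y ^ k := by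
  simp only [mapCoeffs, eval_finsetSum, eval_monomial]

theorem coeff_mapCoeffs (hφ : φ 0 = 0) (P : A[X]) (k : ℕ) :
    (mapCoeffs φ P).coeff k = φ (P.coeff k) := by
  simp only [mapCoeffs, finsetSum_coeff, coeff_monomial, Finset.sum_ite_eq', Finset.mem_range,
    ite_eq_left_iff, not_lt]
  intro hk
  rw [coeff_eq_zero_of_natDegree_lt hk, hφ]

theorem mapCoeffs_one (hφ : φ 0 = 0) (hφ' : φ 1 = 1) : mapCoeffs φ 1 = 1 := by
  ext k
  rw [coeff_mapCoeffs hφ, coeff_one, coeff_one, apply_ite φ, hφ, hφ']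

theorem map_mapCoeffs (f : B →+* C) (φ : A → B) (P : A[X]) :
    (mapCoeffs φ P).map f = mapCoeffs (f ∘ φ) P := by
  simp only [mapCoeffs, Polynomial.map_sum, map_monomial, Function.comp_apply]

end MapCoeffs

namespace TMax

variable {Γ : Type*} [AddCommGroup Γ] [LinearOrder Γ] [IsOrderedAddMonoid Γ]

instance : IdemCommSemiring (TMax Γ) where
  bot := 0
  bot_le := zero_le'

instance : LinearOrderedCommMonoidWithZero (TMax Γ) where
  isBot_zero := zero_le'
  bot_le := zero_le'
  zero_mul := zero_mul
  mul_zero := mul_zero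
  mul_lt_mul_of_pos_left _ hc _ _ h := mul_strictMono hc.ne' h

theorem exists_eq_sum {ι : Type*} {s : Finset ι} (hs : s.Nonempty) (f : ι → TMax Γ) :
    ∃ i ∈ s, f i = ∑ i ∈ s, f i := by
  refine Finset.sum_induction_nonempty f (fun a => ∃ i ∈ s, f i = a) ?_ hs fun i hi => ⟨i, hi, rfl⟩
  intro a b ha hb
  rcases max_choice a b with h | h <;> rwa [add_eq_max, h]

theorem coeff_mul_pow_le_eval (p : (TMax Γ)[X]) (c : TMax Γ) (k : ℕ) :
    p.coeff k * c ^ k ≤ p.eval c := by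
  rw [eval_eq_sum_range' (show p.natDegree < p.natDegree + k + 1 by omega)]
  exact Finset.single_le_sum_of_canonicallyOrdered (f := fun k => p.coeff k * c ^ k)
    (Finset.mem_range.2 (by omega))

theorem exists_least_coeff_mul_pow_eq_eval (p : (TMax Γ)[X]) (c : TMax Γ) :
    ∃ k, p.coeff k * c ^ k = p.eval c ∧ ∀ j < k, p.coeff j * c ^ j < p.eval c := by
  classical
  have attained : ∃ k, p.coeff k * c ^ k = p.eval c := by
    obtain ⟨k, -, hk⟩ := exists_eq_sum (Finset.nonempty_range_add_one (n := p.natDegree))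
      fun k => p.coeff k * c ^ k
    exact ⟨k, hk.trans (eval_eq_sum_range c).symm⟩
  exact ⟨Nat.find attained, Nat.find_spec attained, fun j hj =>
    (coeff_mul_pow_le_eval p c j).lt_of_ne (Nat.find_min attained hj)⟩

theorem eval_mono {p q : (TMax Γ)[X]} (h : ∀ k, p.coeff k ≤ q.coeff k) (c : TMax Γ) :
    p.eval c ≤ q.eval c := by
  obtain ⟨k, hk, -⟩ := exists_least_coeff_mul_pow_eq_eval p c
  rw [← hk]
  exact (mul_le_mul_left (h k) _).trans (coeff_mul_pow_le_eval q c k)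

section Gauss

variable {R : Type*} [CommRing R] (v : Valuation R (TMax Γ))

theorem valuation_coeff_mul_le (P Q : R[X]) (k : ℕ) :
    v ((P * Q).coeff k) ≤ (mapCoeffs v P * mapCoeffs v Q).coeff k := by
  simp only [coeff_mul, coeff_mapCoeffs v.map_zero, ← v.map_mul]
  exact Finset.le_sum_of_subadditive v v.map_zero.le v.map_add _ _

theorem eval_mapCoeffs_mul_eval_mapCoeffs_le (P Q : R[X]) (c : TMax Γ) :
    (mapCoeffs v P).eval c * (mapCoeffs v Q).eval c ≤ (mapCoeffs v (P * Q)).eval c := by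
  obtain ⟨i, hi, hi_least⟩ := exists_least_coeff_mul_pow_eq_eval (mapCoeffs v P) c
  obtain ⟨j, hj, hj_least⟩ := exists_least_coeff_mul_pow_eq_eval (mapCoeffs v Q) c
  have hP_le := coeff_mul_pow_le_eval (mapCoeffs v P) c
  have hQ_le := coeff_mul_pow_le_eval (mapCoeffs v Q) c
  simp only [coeff_mapCoeffs v.map_zero] at hi hi_least hj hj_least hP_le hQ_le
  set p := (mapCoeffs v P).eval c
  set q := (mapCoeffs v Q).eval c
  rcases eq_or_ne p 0 with hp | hp
  · simp only [hp, zero_mul, zero_le']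
  rcases eq_or_ne q 0 with hq | hq
  · simp only [hq, mul_zero, zero_le']
  have term_eq (a b : ℕ) : v (P.coeff a * Q.coeff b) * c ^ (a + b) =
      (v (P.coeff a) * c ^ a) * (v (Q.coeff b) * c ^ b) := by
    rw [v.map_mul, pow_add, mul_mul_mul_comm]
  -- Any other product on the antidiagonal has a factor preceding the least dominant term.
  have dominant : v ((P * Q).coeff (i + j)) = v (P.coeff i * Q.coeff j) := by
    rw [coeff_mul]
    refine v.map_sum_eq_of_lt (j := (i, j)) (by simp) ?_
    rintro ⟨a, b⟩ hab
    rw [Finset.mem_sdiff, Finset.mem_singleton, Finset.HasAntidiagonal.mem_antidiagonal] at hab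
    have smaller_index : a < i ∨ b < j := by grind
    refine lt_of_mul_lt_mul_right' (a := c ^ (i + j)) ?_
    rw [term_eq i j, hi, hj, ← hab.1, term_eq a b]
    rcases smaller_index with ha | hb
    · exact mul_lt_mul_of_lt_of_le_of_nonneg_of_pos (hi_least a ha) (hQ_le b) (zero_le' _)
        (pos_of_ne_zero hq)
    · exact mul_lt_mul_of_le_of_lt_of_nonneg_of_pos (hP_le a) (hj_least b hb) (zero_le' _)
        (pos_of_ne_zero hp)
  calc p * q = v ((P * Q).coeff (i + j)) * c ^ (i + j) := by rw [dominant, term_eq, hi, hj]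
    _ ≤ (mapCoeffs v (P * Q)).eval c := by
      rw [← coeff_mapCoeffs v.map_zero]
      exact coeff_mul_pow_le_eval _ c _

theorem eval_mapCoeffs_mul (P Q : R[X]) (c : TMax Γ) :
    (mapCoeffs v (P * Q)).eval c = (mapCoeffs v P).eval c * (mapCoeffs v Q).eval c := by
  refine le_antisymm ?_ (eval_mapCoeffs_mul_eval_mapCoeffs_le v P Q c)
  rw [← eval_mul]
  refine eval_mono (fun k => ?_) c
  rw [coeff_mapCoeffs v.map_zero]
  exact valuation_coeff_mul_le v P Q k

theorem eval_mapCoeffs_prod {ι : Type*} (s : Finset ι) (f : ι → R[X]) (c : TMax Γ) :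
    (mapCoeffs v (∏ i ∈ s, f i)).eval c = ∏ i ∈ s, (mapCoeffs v (f i)).eval c := by
  classical
  induction s using Finset.induction_on with
  | empty => simp only [Finset.prod_empty, mapCoeffs_one v.map_zero v.map_one, eval_one]
  | insert i s hi ih => rw [Finset.prod_insert hi, Finset.prod_insert hi, eval_mapCoeffs_mul, ih]

end Gauss

end TMax

namespace SemiringSystem

section Surpass

variable {A : Type*} [CommSemiring A] (S : SemiringSystem A)

theorem surpass_sum {ι : Type*} {s : Finset ι} {f g : ι → A}
    (h : ∀ i ∈ s, S.surpass (f i) (g i)) : S.surpass (∑ i ∈ s, f i) (∑ i ∈ s, g i) := by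
  classical
  induction s using Finset.induction_on with
  | empty => exact S.refl 0
  | insert i s hi ih =>
    rw [Finset.forall_mem_insert] at h
    rw [Finset.sum_insert hi, Finset.sum_insert hi]
    exact S.add_compat _ _ _ _ h.1 (ih h.2)

theorem surpass_pow {a b : A} (h : S.surpass a b) (k : ℕ) : S.surpass (a ^ k) (b ^ k) := by
  induction k with
  | zero => rw [pow_zero, pow_zero]; exact S.refl 1
  | succ k ih => rw [pow_succ, pow_succ]; exact S.mul_compat _ _ _ _ ih h

theorem surpass_eval {p q : A[X]} (hpq : ∀ k, S.surpass (p.coeff k) (q.coeff k)) {a b : A}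
    (hab : S.surpass a b) : S.surpass (p.eval a) (q.eval b) := by
  rw [eval_eq_sum_range' (show p.natDegree < max p.natDegree q.natDegree + 1 by omega),
    eval_eq_sum_range' (show q.natDegree < max p.natDegree q.natDegree + 1 by omega)]
  exact S.surpass_sum fun k _ => S.mul_compat _ _ _ _ (hpq k) (S.surpass_pow hab k)

end Surpass

namespace IsMorphism

theorem map_sum_surpass {A B : Type*} [CommSemiring A] [CommSemiring B] {S : SemiringSystem A}
    {T : SemiringSystem B} {φ : A → B} (h : S.IsMorphism T φ) {ι : Type*} (s : Finset ι)
    (f : ι → A) : T.surpass (φ (∑ i ∈ s, f i)) (∑ i ∈ s, φ (f i)) := by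
  classical
  induction s using Finset.induction_on with
  | empty =>
    rw [Finset.sum_empty, Finset.sum_empty, h.map_zero]
    exact T.refl 0
  | insert i s hi ih =>
    rw [Finset.sum_insert hi, Finset.sum_insert hi]
    exact T.trans _ _ _ (h.map_add _ _) (T.add_compat _ _ _ _ (T.refl _) ih)

section Field

variable {K B : Type*} [Field K] [CommSemiring B] {T : SemiringSystem B} {φ : K → B}
  (h : (fieldSystem K).IsMorphism T φ)

include h

theorem map_mul_of_field (a b : K) : φ (a * b) = φ a * φ b := by
  rcases eq_or_ne a 0 with rfl | ha
  · rw [zero_mul, h.map_zero, zero_mul]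
  · exact h.map_mul a ha b

theorem map_one_of_field : φ 1 = 1 := by
  refine T.cancel (φ 1) (h.map_tangible 1 one_ne_zero) _ _ ?_
  rw [← h.map_mul_of_field, mul_one, mul_one]

theorem map_pow_of_field (a : K) (k : ℕ) : φ (a ^ k) = φ a ^ k := by
  induction k with
  | zero => rw [pow_zero, pow_zero, h.map_one_of_field]
  | succ k ih => rw [pow_succ, pow_succ, h.map_mul_of_field, ih]

theorem map_eval_surpass (P : K[X]) (a : K) :
    T.surpass (φ (P.eval a)) ((mapCoeffs φ P).eval (φ a)) := by
  rw [eval_eq_sum_range, eval_mapCoeffs]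
  simp only [← h.map_pow_of_field, ← h.map_mul_of_field]
  exact h.map_sum_surpass _ _

theorem mapCoeffs_X_sub_C (a : K) : mapCoeffs φ (X - C a) = X + C (T.neg (φ a)) := by
  have map_neg : φ (-a) = T.neg (φ a) := h.map_neg a
  ext (_ | _ | k) <;>
    simp [coeff_mapCoeffs h.map_zero, coeff_X, coeff_C, h.map_zero, h.map_one_of_field, map_neg]

theorem eval_mapCoeffs_mul_surpass (P Q : K[X]) (y : B) :
    T.surpass ((mapCoeffs φ (P * Q)).eval y)
      ((mapCoeffs φ P).eval y * (mapCoeffs φ Q).eval y) := by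
  rw [← eval_mul]
  refine T.surpass_eval (fun k => ?_) (T.refl y)
  simp only [coeff_mul, coeff_mapCoeffs h.map_zero, ← h.map_mul_of_field]
  exact h.map_sum_surpass _ _

theorem eval_mapCoeffs_prod_surpass {ι : Type*} (s : Finset ι) (f : ι → K[X]) (y : B) :
    T.surpass ((mapCoeffs φ (∏ i ∈ s, f i)).eval y) (∏ i ∈ s, (mapCoeffs φ (f i)).eval y) := by
  classical
  induction s using Finset.induction_on with
  | empty =>
    simp only [Finset.prod_empty, mapCoeffs_one h.map_zero h.map_one_of_field, eval_one]
    exact T.refl 1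
  | insert i s hi ih =>
    rw [Finset.prod_insert hi, Finset.prod_insert hi]
    exact T.trans _ _ _ (h.eval_mapCoeffs_mul_surpass _ _ y) (T.mul_compat _ _ _ _ (T.refl _) ih)

end Field

end IsMorphism

end SemiringSystem

namespace SMax

variable {Γ : Type*} [AddCommGroup Γ] [LinearOrder Γ] [IsOrderedAddMonoid Γ]

/-- The modulus `|(a₁, a₂)| = a₁ ⊕ a₂`, as a morphism of semirings from `S_max(Γ)` to
`T_max(Γ)`. -/
def modulus : SMax Γ →+* TMax Γ where
  toFun := Quotient.lift (fun a : TPair Γ => a.fst + a.snd) fun a b h => by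
    rcases (TPair.rel_iff a b).1 h with rfl | ⟨ha, hb, hab⟩ | ⟨ha, hb, hab⟩
    · rfl
    · rw [TMax.add_eq_max, TMax.add_eq_max, max_eq_left ha.le, max_eq_left hb.le, hab]
    · rw [TMax.add_eq_max, TMax.add_eq_max, max_eq_right ha.le, max_eq_right hb.le, hab]
  map_zero' := zero_add (0 : TMax Γ)
  map_one' := add_zero (1 : TMax Γ)
  map_add' a b := by
    obtain ⟨a₁, a₂, rfl⟩ := exists_mk a
    obtain ⟨b₁, b₂, rfl⟩ := exists_mk b
    exact add_add_add_comm a₁ b₁ a₂ b₂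
  map_mul' a b := by
    obtain ⟨a₁, a₂, rfl⟩ := exists_mk a
    obtain ⟨b₁, b₂, rfl⟩ := exists_mk b
    change (a₁ * b₁ + a₂ * b₂) + (a₁ * b₂ + a₂ * b₁) = (a₁ + a₂) * (b₁ + b₂)
    ring

theorem modulus_mk (a₁ a₂ : TMax Γ) : modulus (mk a₁ a₂) = a₁ + a₂ := rfl

theorem modulus_le_of_surpass {a b : SMax Γ} (h : Surpass a b) : modulus a ≤ modulus b := by
  obtain ⟨c, -, rfl⟩ := h
  rw [map_add]
  exact le_self_add

theorem mk_mem_balanced {a₁ a₂ : TMax Γ} : mk a₁ a₂ ∈ balanced Γ ↔ a₁ = a₂ := by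
  simp only [balanced, Set.mem_ofPred_eq, mk_self_eq]
  exact ⟨fun ⟨_, h₁, h₂⟩ => h₁.trans h₂.symm, fun h => ⟨a₁, rfl, h.symm⟩⟩

theorem zero_surpass_iff {a : SMax Γ} : Surpass 0 a ↔ a ∈ balanced Γ := by
  simp only [Surpass, zero_add, exists_eq_right']

theorem mem_tangible_iff {a : SMax Γ} : a ∈ (system Γ).tangible ↔ a ∉ balanced Γ := by
  constructor
  · rintro ⟨⟨c, rfl⟩ | ⟨c, rfl⟩, ha⟩ hb <;> rw [mk_mem_balanced] at hb <;> subst hb <;>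
      exact ha rfl
  · intro ha
    refine ⟨?_, fun h => ha (h ▸ zero_mem_balanced)⟩
    obtain ⟨a₁, a₂, rfl⟩ := exists_mk a
    rw [mk_mem_balanced] at ha
    rcases lt_or_gt_of_ne ha with hlt | hlt
    · exact Or.inr ⟨a₂, mk_eq_mk.2 ((TPair.rel_iff _ _).2
        (Or.inr (Or.inr ⟨hlt, (TMax.zero_le' _).trans_lt hlt, rfl⟩)))⟩
    · exact Or.inl ⟨a₁, mk_eq_mk.2 ((TPair.rel_iff _ _).2
        (Or.inr (Or.inl ⟨hlt, (TMax.zero_le' _).trans_lt hlt, rfl⟩)))⟩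

theorem exists_mem_balanced_of_prod_mem_balanced {ι : Type*} {s : Finset ι} {f : ι → SMax Γ}
    (h : ∏ i ∈ s, f i ∈ balanced Γ) : ∃ i ∈ s, f i ∈ balanced Γ := by
  contrapose! h
  simp only [← mem_tangible_iff] at h ⊢
  exact prod_mem h

theorem eq_of_surpass_of_notMem_balanced {a b : SMax Γ} (h : Surpass a b)
    (hb : b ∉ balanced Γ) : a = b := by
  obtain ⟨_, ⟨e, rfl⟩, rfl⟩ := h
  obtain ⟨a₁, a₂, rfl⟩ := exists_mk a
  rw [mk_add_mk, mk_mem_balanced] at hb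
  rw [mk_add_mk, mk_eq_mk, TPair.rel_iff]
  simp only [TMax.add_eq_max, TPair.mk.injEq] at hb ⊢
  grind

theorem modulus_injOn_balanced : Set.InjOn modulus (balanced Γ) := by
  rintro _ ⟨c, rfl⟩ _ ⟨d, rfl⟩ h
  rw [modulus_mk, modulus_mk, add_idem, add_idem] at h
  rw [h]

theorem eq_of_surpass_of_modulus_eq {a b : SMax Γ} (h : Surpass a b)
    (hmod : modulus a = modulus b) (hbal : b ∈ balanced Γ → a ∈ balanced Γ) : a = b := by
  by_cases hb : b ∈ balanced Γ
  · exact modulus_injOn_balanced (hbal hb) hb hmod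
  · exact eq_of_surpass_of_notMem_balanced h hb

theorem surpass_of_add_neg_mem_balanced {a b : SMax Γ} (ha : a ∈ signed Γ)
    (h : b + -a ∈ balanced Γ) : Surpass a b := by
  obtain ⟨b₁, b₂, rfl⟩ := exists_mk b
  rcases ha with ⟨c, rfl⟩ | ⟨c, rfl⟩ <;>
    rw [neg_mk, mk_add_mk, mk_mem_balanced, add_zero] at h
  · exact ⟨mk b₂ b₂, ⟨b₂, rfl⟩, by rw [mk_add_mk, zero_add, h, add_comm]⟩
  · exact ⟨mk b₁ b₁, ⟨b₁, rfl⟩, by rw [mk_add_mk, zero_add, ← h, add_comm]⟩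

section Morphism

variable {K : Type*} [Field K] {sv : K → SMax Γ} (h : (fieldSystem K).IsMorphism (system Γ) sv)

/-- The valuation `|sv|` on the field underlying a morphism `sv` to `S_max(Γ)`. -/
def valuation : Valuation K (TMax Γ) where
  toFun := modulus ∘ sv
  map_zero' := by rw [Function.comp_apply, h.map_zero, map_zero]
  map_one' := by rw [Function.comp_apply, h.map_one_of_field, map_one]
  map_mul' a b := by simp only [Function.comp_apply, h.map_mul_of_field, map_mul]
  map_add_le_max' a b := (modulus_le_of_surpass (h.map_add a b)).trans_eq (map_add modulus _ _)

include h

theorem map_mem_signed (a : K) : sv a ∈ signed Γ := by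
  rcases eq_or_ne a 0 with rfl | ha
  · exact h.map_zero ▸ Or.inl ⟨0, rfl⟩
  · exact (h.map_tangible a ha).1

theorem modulus_eval_mapCoeffs (P : K[X]) (y : SMax Γ) :
    modulus ((mapCoeffs sv P).eval y) = (mapCoeffs (valuation h) P).eval (modulus y) := by
  rw [← eval_map_apply, map_mapCoeffs]
  rfl

theorem modulus_eval_mapCoeffs_prod {ι : Type*} (s : Finset ι) (f : ι → K[X]) (y : SMax Γ) :
    modulus ((mapCoeffs sv (∏ i ∈ s, f i)).eval y) =
      modulus (∏ i ∈ s, (mapCoeffs sv (f i)).eval y) := by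
  simp only [map_prod, modulus_eval_mapCoeffs h, TMax.eval_mapCoeffs_prod]

theorem eval_mapCoeffs_mem_balanced {P : K[X]} {a : K} (ha : P.IsRoot a) {y : SMax Γ}
    (hy : y + -sv a ∈ balanced Γ) : (mapCoeffs sv P).eval y ∈ balanced Γ := by
  have at_root : Surpass 0 ((mapCoeffs sv P).eval (sv a)) := by
    rw [← h.map_zero, ← ha.eq_zero]
    exact h.map_eval_surpass P a
  have root_to_y : Surpass ((mapCoeffs sv P).eval (sv a)) ((mapCoeffs sv P).eval y) :=
    (system Γ).surpass_eval (fun _ => (system Γ).refl _)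
      (surpass_of_add_neg_mem_balanced (map_mem_signed h a) hy)
  exact zero_surpass_iff.1 ((system Γ).trans _ _ _ at_root root_to_y)

end Morphism

end SMax

theorem mainTheorem11_general {K : Type*} [Field K] {Γ : Type*} [AddCommGroup Γ] [LinearOrder Γ]
    [IsOrderedAddMonoid Γ] {sv : K → SMax Γ}
    (hsv : (fieldSystem K).IsMorphism (SMax.system Γ) sv) {ι : Type*} (s : Finset ι) (x : ι → K)
    (y : SMax Γ) :
    (mapCoeffs sv (∏ i ∈ s, (X - C (x i)))).eval y = ∏ i ∈ s, (y + -sv (x i)) := by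
  have eval_factor (i : ι) : y + -sv (x i) = (mapCoeffs sv (X - C (x i))).eval y := by
    rw [hsv.mapCoeffs_X_sub_C, eval_add, eval_X, eval_C]
    rfl
  have balanced_of_balanced (hb : ∏ i ∈ s, (y + -sv (x i)) ∈ SMax.balanced Γ) :
      (mapCoeffs sv (∏ i ∈ s, (X - C (x i)))).eval y ∈ SMax.balanced Γ := by
    obtain ⟨i, hi, hy⟩ := SMax.exists_mem_balanced_of_prod_mem_balanced hb
    refine SMax.eval_mapCoeffs_mem_balanced hsv ?_ hy
    exact (root_X_sub_C.2 rfl).dvd (Finset.dvd_prod_of_mem _ hi)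
  simp only [eval_factor] at balanced_of_balanced ⊢
  exact SMax.eq_of_surpass_of_modulus_eq (hsv.eval_mapCoeffs_prod_surpass s _ y)
    (SMax.modulus_eval_mapCoeffs_prod hsv s _ y) balanced_of_balanced

theorem mainTheorem11 {R : Type*} [Field R] [LinearOrder R] [IsStrictOrderedRing R]
    {Γ : Type*} [AddCommGroup Γ] [LinearOrder Γ] [IsOrderedAddMonoid Γ]
    (hΓ : ∀ m : ℕ, 0 < m → ∀ a : Γ, ∃ b : Γ, m • b = a)
    (sv : R → SMax Γ) (hsv : (fieldSystem R).IsMorphism (SMax.system Γ) sv)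
    (n : ℕ) (x : Fin n → R) (P : R[X]) (hP : P = ∏ i, (X - C (x i))) :
    ∀ y : SMax Γ, (mapCoeffs sv P).eval y = ∏ i, (y + -sv (x i)) := by
  subst hP
  exact mainTheorem11_general hsv Finset.univ x
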